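/- Let $\mathbb I:=[0,1]\setminus\mathbb Q$, let $G:\mathbb I\to\mathbb I$, $G(x):=\frac1x-\lfloor\frac1x\rfloor$, be the Gauss map, and let $a:\mathbb I\to\mathbb N$, $a(x):=\lfloor\frac1x\rfloor$. For a sequence $(x_n)_{n\ge0}$ in $[0,\infty)$ define its extravagance by $$\mathbb e\big((x_n)_{n\ge 0}\big):=\limsup_{n\to\infty}\frac{x_n}{\sum_{k=0}^{n-1}x_k}\in[0,\infty]$$ if $x_n>0$ for some $n$, and by $\mathbb e(\overline 0):=0$ for the zero sequence. For a map $\Phi:\mathbb I\to[0,\infty)$ put $\mathfrak e(\Phi,G)(x):=\mathbb e\big((\Phi(G^nx))_{n\ge0}\big)$. Call $x\in\mathbb I$ badly approximable of order $s>0$ if there are $c>0$ and $Q\ge 1$ such that $\left|x-\frac pq\right|\ge \frac{c}{q^{s}}$ for all integers $q\ge Q$ and $0\le p\le q$, and define the irrationality exponent of $x$ by $$\mathbb i(x):=\inf\{s>0:\ x\text{ is badly approximable of order }s\}\in[0,\infty],\qquad \inf\emptyset:=\infty.$$ Lemma 4.1 (Bugeaud's Lemma). (a) For every $x\in\mathbb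 I$, $$\mathbb i(x)=2+\mathbb e\big((\log\tfrac1{G^nx})_{n\ge0}\big).$$ (b) For every $G$-invariant Borel probability measure $\mu$ on $\mathbb I$, $$\mathbb i(x)=2+\mathfrak e(\log a,G)(x)\qquad\text{for }\mu\text{-a.e. }x\in\mathbb I.$$ -/

import Mathlib

open Filter MeasureTheory

noncomputable section

namespace GaussCF

/-- The space `𝕀 = [0,1] ∖ ℚ` of irrationals in the unit interval, with the topology and the
Borel σ-algebra it has as a subspace of `ℝ`. -/
abbrev UnitIrr : Type := {x : ℝ // x ∈ Set.Icc (0 : ℝ) 1 ∧ Irrational x}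

theorem irrational_fract {y : ℝ} (hy : Irrational y) : Irrational (Int.fract y) := by
  rw [Int.fract]
  exact hy.sub_intCast _

/-- The Gauss map `G x = {1/x} = 1/x - ⌊1/x⌋`, as a self-map of `𝕀`. -/
def gauss (x : UnitIrr) : UnitIrr :=
  ⟨Int.fract (1 / (x : ℝ)),
    ⟨Int.fract_nonneg _, (Int.fract_lt_one _).le⟩,
    irrational_fract (by rw [one_div]; exact x.2.2.inv)⟩

/-- The partial quotient function `a x = ⌊1/x⌋`. -/
def partialQuotient (x : UnitIrr) : ℕ := ⌊1 / (x : ℝ)⌋₊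

/-- The extravagance of a non-negative sequence `(x n : n ≥ 0)`: the upper limit, in the extended
reals, of each term divided by the sum of the preceding terms, and `0` for the zero sequence.
(If some term is positive, only finitely many of the denominators vanish.) -/
def extravagance (x : ℕ → ℝ) : EReal :=
  open Classical in
  if ∃ n, 0 < x n then
    limsup (fun n : ℕ => ((x n / ∑ k ∈ Finset.range n, x k : ℝ) : EReal)) atTop
  else 0

/-- The extravagance of the process `(Φ ∘ τⁿ : n ≥ 0)`, as a function on `Ω`. -/
def processExtravagance {Ω : Type*} (Φ : Ω → ℝ) (τ : Ω → Ω) (ω : Ω) : EReal :=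
  extravagance (fun n => Φ (τ^[n] ω))

/-- `x` is badly approximable of order `s`: `min_{0 ≤ p ≤ q} |x - p/q| ≫ q^{-s}` as `q → ∞`. -/
def BadlyApproximable (s : ℝ) (x : UnitIrr) : Prop :=
  ∃ c : ℝ, 0 < c ∧ ∀ᶠ q : ℕ in atTop, ∀ p : ℕ, p ≤ q →
    c / (q : ℝ) ^ s ≤ |(x : ℝ) - (p : ℝ) / (q : ℝ)|

/-- The irrationality exponent of `x`: the infimum, in the extended reals, of the orders `s > 0`
to which `x` is badly approximable (`⊤` if there are none). -/
def irrationalityExponent (x : UnitIrr) : EReal :=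
  sInf ((fun s : ℝ => (s : EReal)) '' {s : ℝ | 0 < s ∧ BadlyApproximable s x})

end GaussCF

end

/-! Write D_n = x · Gx ⋯ Gⁿ⁻¹x (`orbitProd`). Then D_n = |q_n x - p_n| in the indexing of `convDen`,
and 1/2 ≤ q_{n+1} D_n ≤ 1. As log(1/Gⁿx) = log D_n - log D_{n+1}, the n-th extravagance ratio is
below s - 2 exactly when D_{n+1} > D_n^{s-1}, which up to constants says that |x - p_{n+1}/q_{n+1}|
exceeds q_{n+1}^{-s}. The best approximation property extends this bound to all fractions, which
gives (a).

For (b), log a and log(1/x) differ by at most log 2, so only the effect of a bounded error on the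
extravagance matters. Split by the lower limit of the Birkhoff averages of log a. If it is infinite,
the error is negligible. If it is finite, log a(Gⁿx) = o(n) almost everywhere, while the sums of
log(1/Gᵏx) always grow linearly, so log(1/x) has extravagance 0. So does log a when its lower limit
is positive; when the limit is 0, log a vanishes along almost every orbit and the convention for the
zero sequence applies. The maximal ergodic inequality on invariant sets suffices; ergodicity and
integrability are not needed. -/

namespace GaussCF

/-! ### Continued fraction convergents and best approximation. -/

section Convergents

theorem UnitIrr.pos (x : UnitIrr) : (0 : ℝ) < x :=
  lt_of_le_of_ne x.2.1.1 fun h => x.2.2 ⟨0, by simpa using h⟩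

theorem UnitIrr.lt_one (x : UnitIrr) : (x : ℝ) < 1 :=
  lt_of_le_of_ne x.2.1.2 fun h => x.2.2 ⟨1, by simp [h]⟩

theorem one_le_partialQuotient (x : UnitIrr) : 1 ≤ partialQuotient x := by
  rw [partialQuotient, Nat.one_le_floor_iff, le_div_iff₀ x.pos, one_mul]
  exact x.lt_one.le

theorem one_div_eq_partialQuotient_add (x : UnitIrr) :
    1 / (x : ℝ) = partialQuotient x + gauss x := by
  have h : 0 ≤ 1 / (x : ℝ) := (one_div_pos.2 x.pos).le
  rw [partialQuotient, gauss, natCast_floor_eq_intCast_floor h]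
  exact (Int.floor_add_fract _).symm

theorem mul_gauss (x : UnitIrr) :
    (x : ℝ) * gauss x = 1 - partialQuotient x * x := by
  have h := one_div_eq_partialQuotient_add x
  rw [div_eq_iff x.pos.ne'] at h
  linarith

/-- The product is at most 1 - x because a ≥ 1, and less than x because Gx < 1. This makes
`orbitProd` decay exponentially. -/
theorem mul_gauss_lt_half (x : UnitIrr) : (x : ℝ) * gauss x < 1 / 2 := by
  have h1 : (1 : ℝ) ≤ partialQuotient x := by exact_mod_cast one_le_partialQuotient x
  have h2 := mul_gauss x
  have := x.pos
  have := (gauss x).lt_one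
  nlinarith

/-- The product `x · Gx ⋯ Gⁿ⁻¹x`. -/
noncomputable def orbitProd (x : UnitIrr) (n : ℕ) : ℝ :=
  ∏ k ∈ Finset.range n, (gauss^[k] x : ℝ)

theorem orbitProd_succ (x : UnitIrr) (n : ℕ) :
    orbitProd x (n + 1) = orbitProd x n * (gauss^[n] x : ℝ) :=
  Finset.prod_range_succ _ _

@[simp] theorem orbitProd_zero (x : UnitIrr) : orbitProd x 0 = 1 := by simp [orbitProd]

theorem orbitProd_pos (x : UnitIrr) (n : ℕ) : 0 < orbitProd x n :=
  Finset.prod_pos fun _ _ => UnitIrr.pos _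

theorem orbitProd_succ_lt (x : UnitIrr) (n : ℕ) : orbitProd x (n + 1) < orbitProd x n := by
  rw [orbitProd_succ]
  exact mul_lt_of_lt_one_right (orbitProd_pos x n) (UnitIrr.lt_one _)

theorem orbitProd_le_one (x : UnitIrr) (n : ℕ) : orbitProd x n ≤ 1 := by
  simpa using antitone_nat_of_succ_le (fun k => (orbitProd_succ_lt x k).le) (Nat.zero_le n)

theorem orbitProd_add_two (x : UnitIrr) (n : ℕ) :
    orbitProd x (n + 2) =
      orbitProd x n - partialQuotient (gauss^[n] x) * orbitProd x (n + 1) := by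
  rw [orbitProd_succ, orbitProd_succ, Function.iterate_succ_apply', mul_assoc, mul_gauss]
  ring

theorem orbitProd_add_two_le (x : UnitIrr) (n : ℕ) :
    orbitProd x (n + 2) ≤ orbitProd x n / 2 := by
  rw [orbitProd_succ, orbitProd_succ, Function.iterate_succ_apply', mul_assoc]
  have := mul_gauss_lt_half (gauss^[n] x)
  have := orbitProd_pos x n
  nlinarith

theorem sum_log_one_div (x : UnitIrr) (n : ℕ) :
    ∑ k ∈ Finset.range n, Real.log (1 / (gauss^[k] x : ℝ)) = -Real.log (orbitProd x n) := by
  rw [orbitProd, Real.log_prod fun k _ => (UnitIrr.pos _).ne', ← Finset.sum_neg_distrib]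
  simp

theorem orbitProd_le_pow (x : UnitIrr) (n : ℕ) : orbitProd x n ≤ (1 / 2) ^ (n / 2) := by
  induction n using Nat.strong_induction_on with
  | _ n ih =>
    match n with
    | 0 => simp
    | 1 => simpa using orbitProd_le_one x 1
    | m + 2 =>
      have h := ih m (by omega)
      have h2 := orbitProd_add_two_le x m
      rw [show (m + 2) / 2 = m / 2 + 1 by omega, pow_succ]
      linarith

theorem tendsto_orbitProd (x : UnitIrr) : Tendsto (orbitProd x) atTop (nhds 0) := by
  refine squeeze_zero (fun n => (orbitProd_pos x n).le) (orbitProd_le_pow x) ?_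
  exact (tendsto_pow_atTop_nhds_zero_of_lt_one (by norm_num) (by norm_num)).comp
    (Nat.tendsto_div_const_atTop two_ne_zero)

/-- Denominators of the convergents of `x`, starting with `q₋₁ = 0`, `q₀ = 1`. -/
noncomputable def convDen (x : UnitIrr) : ℕ → ℕ
  | 0 => 0
  | 1 => 1
  | n + 2 => partialQuotient (gauss^[n] x) * convDen x (n + 1) + convDen x n

/-- Numerators of the convergents of `x`, starting with `p₋₁ = 1`, `p₀ = 0`. -/
noncomputable def convNum (x : UnitIrr) : ℕ → ℕ
  | 0 => 1
  | 1 => 0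
  | n + 2 => partialQuotient (gauss^[n] x) * convNum x (n + 1) + convNum x n

theorem convDen_mul_sub_convNum (x : UnitIrr) (n : ℕ) :
    convDen x n * (x : ℝ) - convNum x n = (-1) ^ (n + 1) * orbitProd x n := by
  induction n using Nat.twoStepInduction with
  | zero => simp [convDen, convNum]
  | one => simp [convDen, convNum, orbitProd]
  | more n h0 h1 =>
    rw [orbitProd_add_two, convDen, convNum]
    push_cast
    linear_combination (partialQuotient (gauss^[n] x) : ℝ) * h1 + h0

/-- The recursions for `convDen` and `orbitProd` leave this expression unchanged. It yields both
bounds 1/2 ≤ q_{n+1} D_n ≤ 1. -/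
theorem convDen_orbitProd (x : UnitIrr) (n : ℕ) :
    convDen x (n + 1) * orbitProd x n + convDen x n * orbitProd x (n + 1) = 1 := by
  induction n with
  | zero => simp [convDen]
  | succ n ih =>
    rw [orbitProd_add_two, convDen]
    push_cast
    linear_combination ih

theorem convNum_convDen_det (x : UnitIrr) (n : ℕ) :
    (convNum x (n + 1) * convDen x n - convNum x n * convDen x (n + 1) : ℤ) =
      (-1) ^ (n + 1) := by
  induction n with
  | zero => simp [convDen, convNum]
  | succ n ih =>
    rw [convDen, convNum]
    push_cast
    linear_combination -ih

theorem convDen_le_succ (x : UnitIrr) (n : ℕ) : convDen x n ≤ convDen x (n + 1) := by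
  cases n with
  | zero => simp [convDen]
  | succ n =>
    rw [convDen]
    have := Nat.mul_le_mul_right (convDen x (n + 1)) (one_le_partialQuotient (gauss^[n] x))
    omega

theorem convDen_succ_pos (x : UnitIrr) (n : ℕ) : 0 < convDen x (n + 1) :=
  lt_of_lt_of_le (by simp [convDen])
    (monotone_nat_of_le_succ (convDen_le_succ x) (Nat.le_add_left 1 n))

theorem convNum_succ_le (x : UnitIrr) (n : ℕ) : convNum x (n + 1) ≤ convDen x (n + 1) := by
  induction n using Nat.twoStepInduction with
  | zero => simp [convDen, convNum]
  | one =>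
    have := one_le_partialQuotient x
    simpa [convDen, convNum] using this
  | more n h0 h1 =>
    rw [convDen, convNum]
    exact Nat.add_le_add (Nat.mul_le_mul_left _ h1) h0

theorem convDen_mul_orbitProd_le (x : UnitIrr) (n : ℕ) :
    convDen x (n + 1) * orbitProd x n ≤ 1 := by
  have := convDen_orbitProd x n
  have : 0 ≤ convDen x n * orbitProd x (n + 1) :=
    mul_nonneg (Nat.cast_nonneg _) (orbitProd_pos x _).le
  linarith

theorem half_le_convDen_mul_orbitProd (x : UnitIrr) (n : ℕ) :
    1 / 2 ≤ convDen x (n + 1) * orbitProd x n := by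
  have h := convDen_orbitProd x n
  have h1 : (convDen x n : ℝ) ≤ convDen x (n + 1) := by exact_mod_cast convDen_le_succ x n
  have := mul_le_mul h1 (orbitProd_succ_lt x n).le (orbitProd_pos x _).le (Nat.cast_nonneg _)
  linarith

theorem tendsto_convDen (x : UnitIrr) : Tendsto (convDen x) atTop atTop := by
  rw [← tendsto_add_atTop_iff_nat 1]
  refine (tendsto_natCast_atTop_iff (R := ℝ)).1 ?_
  have h0 : Tendsto (orbitProd x) atTop (nhdsWithin 0 (Set.Ioi 0)) :=
    tendsto_nhdsWithin_iff.2 ⟨tendsto_orbitProd x, .of_forall (orbitProd_pos x)⟩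
  refine tendsto_atTop_mono (fun n => ?_)
    (h0.inv_tendsto_nhdsGT_zero.const_mul_atTop (show (0 : ℝ) < 1 / 2 by norm_num))
  rw [Pi.inv_apply, ← div_eq_mul_inv, div_le_iff₀ (orbitProd_pos x n)]
  exact half_le_convDen_mul_orbitProd x n

/-- Best approximation property of the convergents. -/
theorem orbitProd_le_abs_mul_sub (x : UnitIrr) (n : ℕ) {q : ℕ} (hq : 0 < q)
    (hqn : q < convDen x (n + 1)) (p : ℕ) : orbitProd x n ≤ |q * (x : ℝ) - p| := by
  -- Consecutive convergents have determinant ±1, so they form a basis of ℤ²; u and v come from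
  -- Cramer's rule.
  obtain ⟨u, v, hu, hv⟩ : ∃ u v : ℤ, (q : ℤ) = u * convDen x n + v * convDen x (n + 1) ∧
      (p : ℤ) = u * convNum x n + v * convNum x (n + 1) := by
    have hd := convNum_convDen_det x n
    have hs : ((-1 : ℤ) ^ (n + 1)) * (-1) ^ (n + 1) = 1 := by
      rw [← mul_pow]; simp
    refine ⟨(-1) ^ (n + 1) * (q * convNum x (n + 1) - p * convDen x (n + 1)),
      (-1) ^ (n + 1) * (p * convDen x n - q * convNum x n), ?_, ?_⟩
    · linear_combination (-(-1) ^ (n + 1) * (q : ℤ)) * hd - (q : ℤ) * hs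
    · linear_combination (-(-1) ^ (n + 1) * (p : ℤ)) * hd - (p : ℤ) * hs
  have key : (q * (x : ℝ) - p) =
      (-1) ^ (n + 1) * (u * orbitProd x n - v * orbitProd x (n + 1)) := by
    have hu' : (q : ℝ) = u * convDen x n + v * convDen x (n + 1) := by exact_mod_cast hu
    have hv' : (p : ℝ) = u * convNum x n + v * convNum x (n + 1) := by exact_mod_cast hv
    rw [hu', hv']
    linear_combination (u : ℝ) * convDen_mul_sub_convNum x n +
      (v : ℝ) * convDen_mul_sub_convNum x (n + 1)
  rw [key, abs_mul, abs_pow, abs_neg, abs_one, one_pow, one_mul]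
  have hD := orbitProd_pos x n
  have hD' := orbitProd_pos x (n + 1)
  have hq' : (0 : ℤ) < q := by exact_mod_cast hq
  have hqn' : (q : ℤ) < convDen x (n + 1) := by exact_mod_cast hqn
  have hc : (0 : ℤ) ≤ convDen x n := by positivity
  -- The range of q forces u ≠ 0 and gives v the opposite sign or 0, so the two terms in `key`
  -- reinforce each other.
  rcases lt_trichotomy u 0 with hu0 | hu0 | hu0
  · have hv0 : 0 ≤ v := by
      by_contra! h
      nlinarith
    have h1 : (u : ℝ) ≤ -1 := by exact_mod_cast (by omega : u ≤ -1)
    have h2 : (0 : ℝ) ≤ v := by exact_mod_cast hv0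
    refine le_trans ?_ (neg_le_abs _)
    nlinarith
  · exfalso
    subst hu0
    rcases le_or_gt v 0 with h | h <;> nlinarith
  · have hv0 : v ≤ 0 := by
      by_contra! h
      nlinarith
    have h1 : (1 : ℝ) ≤ u := by exact_mod_cast hu0
    have h2 : (v : ℝ) ≤ 0 := by exact_mod_cast hv0
    refine le_trans ?_ (le_abs_self _)
    nlinarith

end Convergents

/-! ### The irrationality exponent and the sizes of orbit products. -/

section Exponent

/-- For q_{n+1} ≤ q < q_{n+2}, best approximation gives |qx - p| ≥ D_{n+1} ≥ D_n^{s-1} ≥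
(1/(2q))^{s-1}; hence the constant (1/2)^(s-1). -/
theorem badlyApproximable_of_eventually (x : UnitIrr) {s : ℝ} (hs : 1 ≤ s)
    (h : ∀ᶠ n in atTop, orbitProd x n ^ (s - 1) ≤ orbitProd x (n + 1)) :
    BadlyApproximable s x := by
  obtain ⟨N, hN⟩ := eventually_atTop.1 h
  refine ⟨(1 / 2) ^ (s - 1), by positivity, ?_⟩
  filter_upwards [eventually_ge_atTop (convDen x (N + 1)), eventually_gt_atTop 0]
    with q hqN hq p _
  have hex : ∃ m, q < convDen x m := ((tendsto_convDen x).eventually_gt_atTop q).exists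
  obtain ⟨m, hm, hmin⟩ : ∃ m, q < convDen x m ∧ ∀ k < m, convDen x k ≤ q :=
    open Classical in
    ⟨Nat.find hex, Nat.find_spec hex, fun k hk => not_lt.1 (Nat.find_min hex hk)⟩
  have hNm : N + 1 < m := by
    by_contra! hle
    exact absurd (lt_of_lt_of_le hm (monotone_nat_of_le_succ (convDen_le_succ x) hle))
      (not_lt.2 hqN)
  obtain ⟨n, rfl⟩ : ∃ n, m = n + 1 + 1 := ⟨m - 2, by omega⟩
  have hq0 : (0 : ℝ) < q := by exact_mod_cast hq
  have hden : (convDen x (n + 1) : ℝ) ≤ q := by exact_mod_cast hmin (n + 1) (by omega)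
  have hD := orbitProd_pos x n
  have h1 : 1 / 2 / (q : ℝ) ≤ orbitProd x n := by
    rw [div_le_iff₀ hq0]
    have := half_le_convDen_mul_orbitProd x n
    nlinarith
  have h2 : (1 / 2 / (q : ℝ)) ^ (s - 1) ≤ |q * (x : ℝ) - p| :=
    (Real.rpow_le_rpow (by positivity) h1 (by linarith)).trans
      ((hN n (by omega)).trans (orbitProd_le_abs_mul_sub x (n + 1) hq hm p))
  have h3 : |(x : ℝ) - p / q| = |q * (x : ℝ) - p| / q := by
    rw [← abs_of_pos hq0, ← abs_div, abs_of_pos hq0]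
    congr 1
    field_simp
  rw [h3, le_div_iff₀ hq0]
  refine le_trans (le_of_eq ?_) h2
  rw [Real.div_rpow (by norm_num) hq0.le, Real.rpow_sub_one hq0.ne']
  field_simp

/-- The convergents themselves violate order s: infinitely often their error is at most q^{-t},
which is eventually below c q^{-s}. -/
theorem not_badlyApproximable_of_frequently (x : UnitIrr) {s t : ℝ} (ht : 1 ≤ t) (hst : s < t)
    (h : ∃ᶠ n in atTop, orbitProd x (n + 1) ≤ orbitProd x n ^ (t - 1)) :
    ¬ BadlyApproximable s x := by
  rintro ⟨c, hc, hev⟩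
  have hq := (tendsto_add_atTop_iff_nat 1).2 (tendsto_convDen x)
  have hsmall : ∀ᶠ q : ℕ in atTop, (q : ℝ) ^ (-(t - s)) < c :=
    ((tendsto_rpow_neg_atTop (sub_pos.2 hst)).comp tendsto_natCast_atTop_atTop).eventually_lt_const
      hc
  obtain ⟨n, hn, hbad, hlt⟩ :=
    (h.and_eventually ((hq.eventually hev).and (hq.eventually hsmall))).exists
  have hq0 : (0 : ℝ) < convDen x (n + 1) := by exact_mod_cast convDen_succ_pos x n
  specialize hbad _ (convNum_succ_le x n)
  have h3 : |(x : ℝ) - convNum x (n + 1) / convDen x (n + 1)| =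
      orbitProd x (n + 1) / convDen x (n + 1) := by
    have h4 := congrArg abs (convDen_mul_sub_convNum x (n + 1))
    rw [abs_mul, abs_pow, abs_neg, abs_one, one_pow, one_mul, abs_of_pos (orbitProd_pos x _)] at h4
    rw [← h4, ← abs_of_pos hq0, ← abs_div, abs_of_pos hq0]
    congr 1
    field_simp
  have h5 : orbitProd x n ≤ (convDen x (n + 1) : ℝ)⁻¹ := by
    rw [← one_div, le_div_iff₀ hq0, mul_comm]
    exact convDen_mul_orbitProd_le x n
  have h6 := Real.rpow_le_rpow (orbitProd_pos x n).le h5 (sub_nonneg.2 ht)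
  rw [Real.inv_rpow hq0.le, ← Real.rpow_neg hq0.le] at h6
  have h7 : c / (convDen x (n + 1) : ℝ) ^ s ≤ (convDen x (n + 1) : ℝ) ^ (-t) := by
    refine hbad.trans ?_
    rw [h3, div_le_iff₀ hq0]
    refine (hn.trans h6).trans (le_of_eq ?_)
    nth_rewrite 3 [← Real.rpow_one (convDen x (n + 1) : ℝ)]
    rw [← Real.rpow_add hq0]
    congr 1
    ring
  rw [div_le_iff₀ (by positivity), ← Real.rpow_add hq0] at h7
  rw [show -t + s = -(t - s) by ring] at h7
  linarith

theorem coe_lt_two_add_iff (s : ℝ) (e : EReal) :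
    (s : EReal) < 2 + e ↔ ((s - 2 : ℝ) : EReal) < e := by
  have h2 : (2 : EReal) = ((2 : ℝ) : EReal) := rfl
  induction e with
  | bot => simp
  | top => exact iff_of_true (by simp [h2]) (EReal.coe_lt_top _)
  | coe e =>
    rw [h2, ← EReal.coe_add, EReal.coe_lt_coe_iff, EReal.coe_lt_coe_iff]
    constructor <;> intro h <;> linarith

theorem two_add_lt_coe_iff (s : ℝ) (e : EReal) :
    2 + e < (s : EReal) ↔ e < ((s - 2 : ℝ) : EReal) := by
  have h2 : (2 : EReal) = ((2 : ℝ) : EReal) := rfl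
  induction e with
  | bot => exact iff_of_true (by simp [EReal.bot_lt_coe]) (EReal.bot_lt_coe _)
  | top => simp [h2]
  | coe e =>
    rw [h2, ← EReal.coe_add, EReal.coe_lt_coe_iff, EReal.coe_lt_coe_iff]
    constructor <;> intro h <;> linarith

theorem log_one_div_pos (x : UnitIrr) : 0 < Real.log (1 / (x : ℝ)) :=
  Real.log_pos (by rw [lt_div_iff₀ x.pos, one_mul]; exact x.lt_one)

theorem log_one_div_div_sum_lt_iff (x : UnitIrr) {n : ℕ} (hn : 0 < n) (s : ℝ) :
    Real.log (1 / (gauss^[n] x : ℝ)) /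
        ∑ k ∈ Finset.range n, Real.log (1 / (gauss^[k] x : ℝ)) < s - 2 ↔
      orbitProd x n ^ (s - 1) < orbitProd x (n + 1) := by
  have hpos : 0 < ∑ k ∈ Finset.range n, Real.log (1 / (gauss^[k] x : ℝ)) :=
    Finset.sum_pos (fun _ _ => log_one_div_pos _) (Finset.nonempty_range_iff.2 hn.ne')
  have hD := orbitProd_pos x n
  rw [div_lt_iff₀ hpos, sum_log_one_div, ← Real.log_lt_log_iff (by positivity)
    (orbitProd_pos x _), Real.log_rpow hD, orbitProd_succ,
    Real.log_mul hD.ne' (UnitIrr.pos _).ne', one_div, Real.log_inv]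
  constructor <;> intro h <;> linarith

theorem extravagance_of_pos {u : ℕ → ℝ} (h : ∃ n, 0 < u n) :
    extravagance u =
      limsup (fun n : ℕ => ((u n / ∑ k ∈ Finset.range n, u k : ℝ) : EReal)) atTop :=
  if_pos h

theorem extravagance_nonneg {u : ℕ → ℝ} (h : ∀ n, 0 ≤ u n) : 0 ≤ extravagance u := by
  by_cases h0 : ∃ n, 0 < u n
  · rw [extravagance_of_pos h0]
    refine le_limsup_of_frequently_le (Frequently.of_forall fun n => ?_)
    exact EReal.coe_nonneg.2 (div_nonneg (h n) (Finset.sum_nonneg fun k _ => h k))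
  · rw [extravagance, if_neg h0]

/-- The irrationality exponent in terms of the extravagance of `log (1 / Gⁿ x)`. -/
theorem irrationalityExponent_eq (x : UnitIrr) :
    irrationalityExponent x =
      2 + extravagance (fun n => Real.log (1 / (gauss^[n] x : ℝ))) := by
  set e := extravagance (fun n => Real.log (1 / (gauss^[n] x : ℝ))) with he
  have he0 : 0 ≤ e := extravagance_nonneg fun n => (log_one_div_pos _).le
  rw [extravagance_of_pos ⟨0, log_one_div_pos _⟩] at he
  have h12 : ((1 : ℝ) : EReal) < 2 + e := by
    rw [coe_lt_two_add_iff]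
    exact lt_of_lt_of_le (EReal.coe_lt_coe_iff.2 (by norm_num : (1 - 2 : ℝ) < 0)) he0
  refine le_antisymm (EReal.le_of_forall_lt_iff_le.1 fun s hs => ?_) (le_sInf ?_)
  · have h1 : (1 : ℝ) < s := EReal.coe_lt_coe_iff.1 (h12.trans hs)
    rw [two_add_lt_coe_iff, he] at hs
    refine sInf_le ⟨s, ⟨by linarith, badlyApproximable_of_eventually x h1.le ?_⟩, rfl⟩
    filter_upwards [eventually_lt_of_limsup_lt hs, eventually_gt_atTop 0] with n hn hn0
    exact ((log_one_div_div_sum_lt_iff x hn0 s).1 (EReal.coe_lt_coe_iff.1 hn)).le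
  · rintro _ ⟨s, ⟨-, hbad⟩, rfl⟩
    by_contra! hlt
    -- The maximum with 1 provides t ≥ 1, so that t - 1 is an admissible exponent for monotonicity.
    have hmax : ((max s 1 : ℝ) : EReal) < 2 + e := by
      rcases max_choice s 1 with h | h <;> rw [h] <;> assumption
    obtain ⟨t, ht1, ht2⟩ := EReal.lt_iff_exists_real_btwn.1 hmax
    rw [EReal.coe_lt_coe_iff, max_lt_iff] at ht1
    rw [coe_lt_two_add_iff, he] at ht2
    refine not_badlyApproximable_of_frequently x ht1.2.le ht1.1 ?_ hbad
    refine ((frequently_lt_of_lt_limsup (by isBoundedDefault) ht2).and_eventually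
      (eventually_gt_atTop 0)).mono fun n hn => not_lt.1 fun hcon => ?_
    exact lt_asymm (EReal.coe_lt_coe_iff.1 hn.1) ((log_one_div_div_sum_lt_iff x hn.2 t).2 hcon)

end Exponent
end GaussCF
namespace GaussCF

/-! ### Maximal ergodic inequality and slow growth along orbits. -/

section Ergodic

variable {Ω : Type*} [MeasurableSpace Ω] {μ : Measure Ω} {T : Ω → Ω} {f φ : Ω → ℝ}

/-- The maximum of the first `N + 1` Birkhoff sums of `φ`, defined recursively. -/
noncomputable def maxBirkhoffSum (T : Ω → Ω) (φ : Ω → ℝ) : ℕ → Ω → ℝ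
  | 0 => fun _ => 0
  | N + 1 => fun x => max 0 (φ x + maxBirkhoffSum T φ N (T x))

omit [MeasurableSpace Ω] in
theorem maxBirkhoffSum_nonneg (N : ℕ) (x : Ω) : 0 ≤ maxBirkhoffSum T φ N x := by
  cases N with
  | zero => exact le_rfl
  | succ N => exact le_max_left _ _

omit [MeasurableSpace Ω] in
theorem maxBirkhoffSum_le_succ (N : ℕ) (x : Ω) :
    maxBirkhoffSum T φ N x ≤ maxBirkhoffSum T φ (N + 1) x := by
  induction N generalizing x with
  | zero => exact le_max_left _ _
  | succ N ih => exact max_le_max le_rfl (add_le_add le_rfl (ih (T x)))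

omit [MeasurableSpace Ω] in
theorem birkhoffSum_le_maxBirkhoffSum (N : ℕ) (x : Ω) :
    birkhoffSum T φ N x ≤ maxBirkhoffSum T φ N x := by
  induction N generalizing x with
  | zero => simp [maxBirkhoffSum]
  | succ N ih =>
    rw [birkhoffSum_succ']
    exact le_max_of_le_right (add_le_add le_rfl (ih (T x)))

theorem measurable_maxBirkhoffSum (hT : Measurable T) (hφ : Measurable φ) (N : ℕ) :
    Measurable (maxBirkhoffSum T φ N) := by
  induction N with
  | zero => exact measurable_const
  | succ N ih => exact measurable_const.max (hφ.add (ih.comp hT))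

theorem integrable_maxBirkhoffSum (hT : MeasurePreserving T μ μ) (hφ : Integrable φ μ) (N : ℕ) :
    Integrable (maxBirkhoffSum T φ N) μ := by
  induction N with
  | zero => exact integrable_zero _ _ _
  | succ N ih =>
    exact (integrable_zero _ _ _).sup (hφ.add (hT.integrable_comp_of_integrable ih))

/-- The maximal ergodic theorem, when almost every orbit has a positive Birkhoff sum. -/
theorem integral_nonneg_of_birkhoffSum_pos (hT : MeasurePreserving T μ μ) (hφm : Measurable φ)
    (hφ : Integrable φ μ) (h : ∀ᵐ x ∂μ, ∃ n, 0 < birkhoffSum T φ n x) : 0 ≤ ∫ x, φ x ∂μ := by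
  set P : ℕ → Set Ω := fun N => {x | 0 < maxBirkhoffSum T φ N x} with hP
  have hPm : ∀ N, MeasurableSet (P N) := fun N =>
    measurableSet_lt measurable_const (measurable_maxBirkhoffSum hT.measurable hφm N)
  have hnonneg : ∀ N, 0 ≤ ∫ x, (P N).indicator φ x ∂μ := by
    intro N
    have hint := integrable_maxBirkhoffSum hT hφ N
    have hcomp : Integrable (fun x => maxBirkhoffSum T φ N (T x)) μ :=
      hT.integrable_comp_of_integrable hint
    have heq : ∫ x, maxBirkhoffSum T φ N (T x) ∂μ = ∫ x, maxBirkhoffSum T φ N x ∂μ := by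
      conv_rhs => rw [← hT.map_eq]
      rw [integral_map hT.measurable.aemeasurable]
      rw [hT.map_eq]
      exact hint.aestronglyMeasurable
    -- Garsia's argument: the difference has integral 0 by invariance. It is at most φ where the
    -- maximum is positive, and at most 0 elsewhere.
    calc (0 : ℝ) = ∫ x, (maxBirkhoffSum T φ N x - maxBirkhoffSum T φ N (T x)) ∂μ := by
          rw [integral_sub hint hcomp, heq, sub_self]
      _ ≤ ∫ x, (P N).indicator φ x ∂μ := by
          refine integral_mono (hint.sub hcomp) (hφ.indicator (hPm N)) fun x => ?_
          have h0 := maxBirkhoffSum_nonneg (T := T) (φ := φ) N (T x)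
          by_cases hx : 0 < maxBirkhoffSum T φ N x
          · rw [Set.indicator_of_mem (show x ∈ P N from hx)]
            cases N with
            | zero => exact absurd hx (lt_irrefl _)
            | succ N =>
              have h1 := maxBirkhoffSum_le_succ (T := T) (φ := φ) N (T x)
              have h2 : maxBirkhoffSum T φ (N + 1) x = φ x + maxBirkhoffSum T φ N (T x) :=
                max_eq_right ((lt_max_iff.1 hx).resolve_left (lt_irrefl _)).le
              linarith
          · rw [Set.indicator_of_notMem (show x ∉ P N from hx)]
            linarith
  have hlim : Tendsto (fun N => ∫ x, (P N).indicator φ x ∂μ) atTop (nhds (∫ x, φ x ∂μ)) := by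
    refine tendsto_integral_of_dominated_convergence (fun x => ‖φ x‖)
      (fun N => (hφ.indicator (hPm N)).aestronglyMeasurable) hφ.norm
      (fun N => .of_forall fun x => norm_indicator_le_norm_self _ _) ?_
    filter_upwards [h] with x ⟨n, hn⟩
    refine tendsto_const_nhds.congr' ?_
    filter_upwards [eventually_ge_atTop n] with N hN
    refine (Set.indicator_of_mem (show x ∈ P N from ?_) _).symm
    exact (hn.trans_le (birkhoffSum_le_maxBirkhoffSum n x)).trans_le
      (monotone_nat_of_le_succ (fun k => maxBirkhoffSum_le_succ k x) hN)
  exact ge_of_tendsto' hlim hnonneg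

/-- If almost every orbit has a Birkhoff average less than `M`, then the mean is at most `M`. -/
theorem lintegral_le_of_birkhoffSum_lt [IsFiniteMeasure μ] (hT : MeasurePreserving T μ μ)
    (hf : Measurable f) (hf0 : ∀ x, 0 ≤ f x) {M : ℝ}
    (h : ∀ᵐ x ∂μ, ∃ n : ℕ, birkhoffSum T f n x < M * n) :
    ∫⁻ x, ENNReal.ofReal (f x) ∂μ ≤ ENNReal.ofReal (M * μ.real Set.univ) := by
  -- Integrability of f is part of what is to be shown, so f is truncated at K and K → ∞ by monotone
  -- convergence.
  have hbound : ∀ K : ℕ, ∫⁻ x, ENNReal.ofReal (min (f x) K) ∂μ ≤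
      ENNReal.ofReal (M * μ.real Set.univ) := by
    intro K
    have hm : Measurable fun x => min (f x) (K : ℝ) := hf.min measurable_const
    have h0 : ∀ x, 0 ≤ min (f x) (K : ℝ) := fun x => le_min (hf0 x) (Nat.cast_nonneg _)
    have hint : Integrable (fun x => min (f x) (K : ℝ)) μ :=
      Integrable.of_bound hm.aestronglyMeasurable K (.of_forall fun x => by
        rw [Real.norm_of_nonneg (h0 x)]
        exact min_le_right _ _)
    rw [← ofReal_integral_eq_lintegral_ofReal hint (.of_forall h0)]
    refine ENNReal.ofReal_le_ofReal ?_
    have hmax := integral_nonneg_of_birkhoffSum_pos (φ := fun x => M - min (f x) (K : ℝ)) hT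
      (measurable_const.sub hm) ((integrable_const M).sub hint) (by
        filter_upwards [h] with x ⟨n, hn⟩
        refine ⟨n, ?_⟩
        have hle : birkhoffSum T (fun x => min (f x) (K : ℝ)) n x ≤ birkhoffSum T f n x :=
          Finset.sum_le_sum fun k _ => min_le_left _ _
        have heq : birkhoffSum T (fun x => M - min (f x) (K : ℝ)) n x =
            M * n - birkhoffSum T (fun x => min (f x) (K : ℝ)) n x := by
          simp only [birkhoffSum, Finset.sum_sub_distrib, Finset.sum_const, Finset.card_range,
            nsmul_eq_mul]
          ring
        rw [heq]
        linarith)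
    rw [integral_sub (integrable_const M) hint, integral_const, smul_eq_mul] at hmax
    linarith
  have hlim : Tendsto (fun K : ℕ => ∫⁻ x, ENNReal.ofReal (min (f x) K) ∂μ) atTop
      (nhds (∫⁻ x, ENNReal.ofReal (f x) ∂μ)) := by
    refine lintegral_tendsto_of_tendsto_of_monotone
      (fun K => (hf.min measurable_const).ennreal_ofReal.aemeasurable)
      (.of_forall fun x K L hKL => ?_) (.of_forall fun x => ?_)
    · exact ENNReal.ofReal_le_ofReal (min_le_min le_rfl (by exact_mod_cast hKL))
    · refine tendsto_const_nhds.congr' ?_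
      filter_upwards [eventually_ge_atTop ⌈f x⌉₊] with K hK
      rw [min_eq_left (Nat.ceil_le.1 hK)]
  exact le_of_tendsto' hlim hbound

theorem tsum_indicator_le_ofReal {t : ℝ} (ht : 0 ≤ t) :
    ∑' n : ℕ, (if (n + 1 : ℝ) ≤ t then 1 else 0 : ENNReal) ≤ ENNReal.ofReal t := by
  refine ENNReal.tsum_le_of_sum_range_le fun N => ?_
  rw [Finset.sum_boole]
  have hsub : (Finset.range N).filter (fun n : ℕ => (n + 1 : ℝ) ≤ t) ⊆ Finset.range ⌊t⌋₊ := by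
    intro n hn
    rw [Finset.mem_filter] at hn
    exact Finset.mem_range.2 (Nat.le_floor (by exact_mod_cast hn.2))
  have hcard := Finset.card_le_card hsub
  rw [Finset.card_range] at hcard
  rw [← ENNReal.ofReal_natCast]
  refine ENNReal.ofReal_le_ofReal (le_trans ?_ (Nat.floor_le ht))
  exact_mod_cast hcard

/-- Borel–Cantelli: by invariance the events (j + 1) f(Tⁿx) ≥ n + 1 have total measure at most (j +
1) ∫ f. -/
theorem tendsto_div_of_lintegral_ne_top (hT : MeasurePreserving T μ μ)
    (hf : Measurable f) (hf0 : ∀ x, 0 ≤ f x) (hfi : ∫⁻ x, ENNReal.ofReal (f x) ∂μ ≠ ⊤) :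
    ∀ᵐ x ∂μ, Tendsto (fun n : ℕ => f (T^[n] x) / n) atTop (nhds 0) := by
  have hae : ∀ᵐ x ∂μ, ∀ j : ℕ, ∀ᶠ n : ℕ in atTop, (j + 1) * f (T^[n] x) < n + 1 := by
    refine ae_all_iff.2 fun j => ?_
    set s : ℕ → Set Ω := fun n => {x | (n + 1 : ℝ) ≤ (j + 1) * f x} with hs
    have hsm : ∀ n, MeasurableSet (s n) := fun n =>
      measurableSet_le measurable_const (measurable_const.mul hf)
    have hsum : ∑' n, μ (T^[n] ⁻¹' s n) ≠ ⊤ := by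
      have h1 : ∀ n, μ (T^[n] ⁻¹' s n) = ∫⁻ x, (s n).indicator 1 x ∂μ := fun n => by
        rw [(hT.iterate n).measure_preimage (hsm n).nullMeasurableSet, lintegral_indicator_one (hsm n)]
      rw [tsum_congr h1, ← lintegral_tsum fun n =>
        ((measurable_one.indicator (hsm n))).aemeasurable]
      refine ne_top_of_le_ne_top (b := ∫⁻ x, ENNReal.ofReal (j + 1) * ENNReal.ofReal (f x) ∂μ) ?_
        (lintegral_mono fun x => ?_)
      · rw [lintegral_const_mul _ hf.ennreal_ofReal]
        exact ENNReal.mul_ne_top ENNReal.ofReal_ne_top hfi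
      · rw [← ENNReal.ofReal_mul (by positivity)]
        refine le_trans (le_of_eq (tsum_congr fun n => ?_))
          (tsum_indicator_le_ofReal (mul_nonneg (by positivity) (hf0 x)))
        classical
        rw [Set.indicator_apply]
        rfl
    filter_upwards [ae_eventually_notMem hsum] with x hx
    filter_upwards [hx] with n hn
    exact not_le.1 hn
  filter_upwards [hae] with x hx
  rw [Metric.tendsto_atTop']
  intro ε hε
  -- The 2 absorbs n + 1 ≤ 2n for n ≥ 1.
  obtain ⟨j, hj⟩ := exists_nat_gt (2 / ε)
  obtain ⟨N, hN⟩ := eventually_atTop.1 (hx j)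
  refine ⟨max N 1, fun n hn => ?_⟩
  have h1 := hN n (by omega)
  have hn1 : (1 : ℝ) ≤ n := by exact_mod_cast (by omega : 1 ≤ n)
  rw [Real.dist_eq, sub_zero, abs_of_nonneg (div_nonneg (hf0 _) (by linarith)),
    div_lt_iff₀ (by linarith)]
  rw [div_lt_iff₀ hε] at hj
  have h3 := hf0 (T^[n] x)
  by_contra! hcon
  nlinarith [mul_le_mul_of_nonneg_left hcon (show (0 : ℝ) ≤ j + 1 by positivity)]

/-- The invariant set on which the lower limit of the Birkhoff averages is, up to the case of
equality, at most `M`. -/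
def slowSet (T : Ω → Ω) (f : Ω → ℝ) (M : ℝ) : Set Ω :=
  {x | ∃ C : ℕ, ∃ᶠ n : ℕ in atTop, birkhoffSum T f n x < M * n + C}

omit [MeasurableSpace Ω] in
-- Passing from x to Tx shifts time by one and drops the term f x; the free constant C absorbs both.
-- Exact invariance lets μ be restricted to the set.
theorem preimage_slowSet (hf0 : ∀ x, 0 ≤ f x) (M : ℝ) :
    T ⁻¹' slowSet T f M = slowSet T f M := by
  ext x
  have hx := hf0 x
  constructor
  · rintro ⟨C, hC⟩
    obtain ⟨C', hC'⟩ := exists_nat_ge (C + f x - M)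
    refine ⟨C', (tendsto_add_atTop_nat 1).frequently (hC.mono fun n hn => ?_)⟩
    rw [birkhoffSum_succ']
    push_cast
    linarith
  · rintro ⟨C, hC⟩
    obtain ⟨C', hC'⟩ := exists_nat_ge (C + M)
    refine ⟨C', (tendsto_sub_atTop_nat 1).frequently ?_⟩
    refine (hC.and_eventually (eventually_ge_atTop 1)).mono fun n hn => ?_
    obtain ⟨m, rfl⟩ : ∃ m, n = m + 1 := ⟨n - 1, by omega⟩
    have h := hn.1
    rw [birkhoffSum_succ'] at h
    push_cast at h
    rw [Nat.add_sub_cancel]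
    linarith

theorem measurable_birkhoffSum (hT : Measurable T) (hf : Measurable f) (n : ℕ) :
    Measurable (birkhoffSum T f n) :=
  Finset.measurable_fun_sum _ fun k _ => hf.comp (hT.iterate k)

theorem measurableSet_slowSet (hT : Measurable T) (hf : Measurable f) (M : ℝ) :
    MeasurableSet (slowSet T f M) := by
  have : slowSet T f M =
      ⋃ C : ℕ, ⋂ N : ℕ, ⋃ n : ℕ, ⋃ _ : N ≤ n, {x | birkhoffSum T f n x < M * n + C} := by
    ext x
    simp [slowSet, frequently_atTop]
  rw [this]
  exact .iUnion fun C => .iInter fun N => .iUnion fun n => .iUnion fun _ =>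
    measurableSet_lt (measurable_birkhoffSum hT hf n) measurable_const

omit [MeasurableSpace Ω] in
theorem exists_birkhoffSum_lt_of_mem_slowSet {M M' : ℝ} (hM : M < M') {x : Ω}
    (hx : x ∈ slowSet T f M) : ∃ n : ℕ, birkhoffSum T f n x < M' * n := by
  obtain ⟨C, hC⟩ := hx
  obtain ⟨N, hN⟩ := exists_nat_ge (C / (M' - M))
  obtain ⟨n, hn, hNn⟩ := (hC.and_eventually (eventually_ge_atTop N)).exists
  refine ⟨n, hn.trans_le ?_⟩
  have h1 : (N : ℝ) ≤ n := by exact_mod_cast hNn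
  rw [div_le_iff₀ (sub_pos.2 hM)] at hN
  nlinarith [mul_le_mul_of_nonneg_right h1 (sub_pos.2 hM).le]

theorem measurePreserving_restrict_of_preimage_eq (hT : MeasurePreserving T μ μ) {E : Set Ω}
    (hE : MeasurableSet E) (hinv : T ⁻¹' E = E) :
    MeasurePreserving T (μ.restrict E) (μ.restrict E) := by
  have h := hT.restrict_preimage hE
  rwa [hinv] at h

/-- On the set where the lower limit of the Birkhoff averages of `f ≥ 0` is finite, `f (Tⁿ x)` is
almost everywhere `o(n)`. -/
theorem ae_tendsto_div_of_mem_slowSet [IsFiniteMeasure μ] (hT : MeasurePreserving T μ μ)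
    (hf : Measurable f) (hf0 : ∀ x, 0 ≤ f x) (M : ℝ) :
    ∀ᵐ x ∂μ, x ∈ slowSet T f M → Tendsto (fun n : ℕ => f (T^[n] x) / n) atTop (nhds 0) := by
  have hE := measurableSet_slowSet hT.measurable hf M
  rw [← ae_restrict_iff' hE]
  have hTE := measurePreserving_restrict_of_preimage_eq hT hE (preimage_slowSet hf0 M)
  refine tendsto_div_of_lintegral_ne_top hTE hf hf0 (ne_top_of_le_ne_top ENNReal.ofReal_ne_top
    -- Any bound above M would do: the slack swallows the constant C for large n.
    (lintegral_le_of_birkhoffSum_lt (M := M + 1) hTE hf hf0 ?_))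
  filter_upwards [ae_restrict_mem hE] with x hx
  exact exists_birkhoffSum_lt_of_mem_slowSet (lt_add_one M) hx

/-- On the set where the lower limit of the Birkhoff averages of `f ≥ 0` vanishes, `f` vanishes
along almost every orbit. -/
theorem ae_eq_zero_of_forall_mem_slowSet [IsFiniteMeasure μ] (hT : MeasurePreserving T μ μ)
    (hf : Measurable f) (hf0 : ∀ x, 0 ≤ f x) :
    ∀ᵐ x ∂μ, (∀ m : ℕ, x ∈ slowSet T f (1 / (m + 1))) → ∀ n, f (T^[n] x) = 0 := by
  set F : Set Ω := ⋂ m : ℕ, slowSet T f (1 / (m + 1)) with hFdef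
  have hF : MeasurableSet F := .iInter fun m => measurableSet_slowSet hT.measurable hf _
  have hinv : T ⁻¹' F = F := by
    simp only [hFdef, Set.preimage_iInter, preimage_slowSet hf0]
  have hTF := measurePreserving_restrict_of_preimage_eq hT hF hinv
  set ν := μ.restrict F with hν
  have hle : ∀ m : ℕ, ∫⁻ x, ENNReal.ofReal (f x) ∂ν ≤
      ENNReal.ofReal (2 * (1 / ((m : ℝ) + 1)) * ν.real Set.univ) := by
    intro m
    refine lintegral_le_of_birkhoffSum_lt hTF hf hf0 ?_
    filter_upwards [ae_restrict_mem hF] with x hx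
    have hpos : (0 : ℝ) < 1 / (m + 1) := by positivity
    exact exists_birkhoffSum_lt_of_mem_slowSet (by linarith) (Set.mem_iInter.1 hx m)
  have hzero : ∫⁻ x, ENNReal.ofReal (f x) ∂ν = 0 := by
    have h := ENNReal.tendsto_ofReal
      (((tendsto_one_div_add_atTop_nhds_zero_nat (𝕜 := ℝ)).const_mul 2).mul_const
        (ν.real Set.univ))
    rw [mul_zero, zero_mul, ENNReal.ofReal_zero] at h
    exact le_antisymm (ge_of_tendsto' h hle) zero_le
  have hf_ae : ∀ᵐ x ∂ν, f x = 0 := by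
    filter_upwards [(lintegral_eq_zero_iff hf.ennreal_ofReal).1 hzero] with x hx
    exact le_antisymm (ENNReal.ofReal_eq_zero.1 hx) (hf0 x)
  have hall : ∀ᵐ x ∂ν, ∀ n, f (T^[n] x) = 0 :=
    ae_all_iff.2 fun n => (hTF.iterate n).quasiMeasurePreserving.ae hf_ae
  filter_upwards [(ae_restrict_iff' hF).1 hall] with x hx hmem
  exact hx (Set.mem_iInter.2 hmem)

end Ergodic
end GaussCF
namespace GaussCF

/-! ### Comparing extravagances of real sequences. -/

section Comparison

variable {f g : ℕ → ℝ}

theorem limsup_coe_le_limsup_coe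
    (h : ∀ r s : ℝ, r < s → (∀ᶠ n in atTop, g n < r) → ∀ᶠ n in atTop, f n ≤ s) :
    limsup (fun n => (f n : EReal)) atTop ≤ limsup (fun n => (g n : EReal)) atTop := by
  refine EReal.le_of_forall_lt_iff_le.1 fun s hs => ?_
  obtain ⟨r, hr, hrs⟩ := EReal.lt_iff_exists_real_btwn.1 hs
  refine limsup_le_of_le (by isBoundedDefault) ?_
  filter_upwards [h r s (EReal.coe_lt_coe_iff.1 hrs)
    ((eventually_lt_of_limsup_lt hr).mono fun n hn => EReal.coe_lt_coe_iff.1 hn)] with n hn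
  exact EReal.coe_le_coe_iff.2 hn

/-- Sequences at bounded distance have the same extravagance if their averages tend to `∞`. -/
theorem extravagance_eq_of_average_unbounded {L : ℝ} (hf0 : ∀ n, 0 ≤ f n)
    (hfg : ∀ n, f n ≤ g n) (hgf : ∀ n, g n ≤ f n + L)
    (hA : ∀ M : ℕ, ∀ᶠ n : ℕ in atTop, M * (n : ℝ) ≤ ∑ k ∈ Finset.range n, f k) :
    extravagance f = extravagance g := by
  have hL : 0 ≤ L := by linarith [hfg 0, hgf 0]
  have hAS : ∀ n, ∑ k ∈ Finset.range n, f k ≤ ∑ k ∈ Finset.range n, g k := fun n =>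
    Finset.sum_le_sum fun k _ => hfg k
  have hSA : ∀ n : ℕ, ∑ k ∈ Finset.range n, g k ≤ ∑ k ∈ Finset.range n, f k + n * L := fun n => by
    refine (Finset.sum_le_sum fun k _ => hgf k).trans (le_of_eq ?_)
    rw [Finset.sum_add_distrib, Finset.sum_const, Finset.card_range, nsmul_eq_mul]
  have hpos : ∀ᶠ n : ℕ in atTop, 0 < n ∧ 0 < ∑ k ∈ Finset.range n, f k := by
    filter_upwards [hA 1, eventually_gt_atTop 0] with n hn hn0
    have : (0 : ℝ) < n := by exact_mod_cast hn0
    exact ⟨hn0, by push_cast at hn; linarith⟩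
  have hex : ∃ n, 0 < f n := by
    obtain ⟨n, -, hn⟩ := hpos.exists
    by_contra! hcon
    exact absurd hn (not_lt.2 (Finset.sum_nonpos fun k _ => hcon k))
  rw [extravagance_of_pos hex, extravagance_of_pos (hex.imp fun n hn => hn.trans_le (hfg n))]
  refine le_antisymm (limsup_coe_le_limsup_coe fun r s hrs hr => ?_)
    (limsup_coe_le_limsup_coe fun r s hrs hr => ?_)
  -- With A, S the sums of f, g, this M gives rS ≤ rA + rLn ≤ rA + (s - r)Mn ≤ sA.
  · obtain ⟨M, hM⟩ := exists_nat_ge (r * L / (s - r))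
    rw [div_le_iff₀ (sub_pos.2 hrs)] at hM
    filter_upwards [hr, hpos, hA M] with n hn ⟨hn0, hAn⟩ hMn
    have hSn := hAn.trans_le (hAS n)
    have hr0 : 0 < r := lt_of_le_of_lt (div_nonneg ((hf0 n).trans (hfg n)) hSn.le) hn
    rw [div_lt_iff₀ hSn] at hn
    rw [div_le_iff₀ hAn]
    have h1 := mul_le_mul_of_nonneg_left (hSA n) hr0.le
    have h2 := mul_le_mul_of_nonneg_right hM (Nat.cast_nonneg (α := ℝ) n)
    have h3 := mul_le_mul_of_nonneg_right hMn (sub_pos.2 hrs).le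
    have h4 := hfg n
    linarith
  -- Here g_n ≤ f_n + L ≤ rA + (s - r)Mn ≤ sA ≤ sS, using n ≥ 1.
  · obtain ⟨M, hM⟩ := exists_nat_ge (L / (s - r))
    rw [div_le_iff₀ (sub_pos.2 hrs)] at hM
    filter_upwards [hr, hpos, hA M] with n hn ⟨hn0, hAn⟩ hMn
    have hSn := hAn.trans_le (hAS n)
    have hr0 : 0 < r := lt_of_le_of_lt (div_nonneg (hf0 n) hAn.le) hn
    rw [div_lt_iff₀ hAn] at hn
    rw [div_le_iff₀ hSn]
    have hn1 : (1 : ℝ) ≤ n := by exact_mod_cast hn0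
    have h1 := mul_le_mul_of_nonneg_left (hAS n) (hr0.trans hrs).le
    have h2 := mul_le_mul_of_nonneg_left hn1 (hL.trans hM)
    have h3 := mul_le_mul_of_nonneg_right hMn (sub_pos.2 hrs).le
    have h4 := hgf n
    linarith

theorem extravagance_eq_zero_of_tendsto (hf0 : ∀ n, 0 ≤ f n) {c : ℝ} (hc : 0 < c)
    (hlim : Tendsto (fun n : ℕ => f n / n) atTop (nhds 0))
    (hA : ∀ᶠ n : ℕ in atTop, c * n ≤ ∑ k ∈ Finset.range n, f k) :
    extravagance f = 0 := by
  by_cases h0 : ∃ n, 0 < f n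
  · rw [extravagance_of_pos h0]
    have hreal : Tendsto (fun n : ℕ => f n / ∑ k ∈ Finset.range n, f k) atTop (nhds 0) := by
      refine squeeze_zero' (.of_forall fun n => div_nonneg (hf0 n)
        (Finset.sum_nonneg fun k _ => hf0 k)) ?_ (by simpa using hlim.div_const c)
      filter_upwards [hA, eventually_gt_atTop 0] with n hn hn0
      have hn0' : (0 : ℝ) < n := by exact_mod_cast hn0
      rw [div_div, mul_comm (n : ℝ)]
      exact div_le_div_of_nonneg_left (hf0 n) (by positivity) hn
    exact (EReal.tendsto_coe.2 hreal).limsup_eq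
  · rw [extravagance, if_neg h0]

end Comparison

/-! ### Replacing log(1/x) by log a almost everywhere. -/

section PartialQuotients

theorem log_partialQuotient_nonneg (x : UnitIrr) : 0 ≤ Real.log (partialQuotient x : ℝ) :=
  Real.log_natCast_nonneg _

theorem log_partialQuotient_le (x : UnitIrr) :
    Real.log (partialQuotient x : ℝ) ≤ Real.log (1 / (x : ℝ)) := by
  have h1 : (1 : ℝ) ≤ partialQuotient x := by exact_mod_cast one_le_partialQuotient x
  refine Real.log_le_log (by linarith) ?_
  rw [one_div_eq_partialQuotient_add]
  linarith [(gauss x).pos]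

theorem log_one_div_le (x : UnitIrr) :
    Real.log (1 / (x : ℝ)) ≤ Real.log (partialQuotient x : ℝ) + Real.log 2 := by
  have h1 : (1 : ℝ) ≤ partialQuotient x := by exact_mod_cast one_le_partialQuotient x
  rw [← Real.log_mul (by linarith) two_ne_zero]
  refine Real.log_le_log (one_div_pos.2 x.pos) ?_
  rw [one_div_eq_partialQuotient_add]
  linarith [(gauss x).lt_one]

/-- From D_n ≤ 2^{-⌊n/2⌋} and ⌊n/2⌋ ≥ n/3 for n ≥ 2. -/
theorem eventually_le_sum_log_one_div (x : UnitIrr) :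
    ∀ᶠ n : ℕ in atTop, Real.log 2 / 3 * n ≤
      ∑ k ∈ Finset.range n, Real.log (1 / (gauss^[k] x : ℝ)) := by
  filter_upwards [eventually_ge_atTop 2] with n hn
  have h := Real.log_le_log (orbitProd_pos x n) (orbitProd_le_pow x n)
  rw [Real.log_pow, one_div, Real.log_inv] at h
  rw [sum_log_one_div]
  have h3 : (n : ℝ) ≤ 3 * (n / 2 : ℕ) := by exact_mod_cast (by omega : n ≤ 3 * (n / 2))
  have := Real.log_pos one_lt_two
  nlinarith

theorem measurable_log_partialQuotient :
    Measurable fun x : UnitIrr => Real.log (partialQuotient x : ℝ) := by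
  have h : Measurable fun x : UnitIrr => partialQuotient x :=
    Nat.measurable_floor.comp (measurable_const.div measurable_subtype_coe)
  exact Real.measurable_log.comp (measurable_from_nat.comp h)

/-- Almost everywhere, `log a` and `log (1 / x)` have the same extravagance. -/
theorem ae_extravagance_log_eq (μ : Measure UnitIrr) [IsFiniteMeasure μ]
    (hμ : MeasurePreserving gauss μ μ) :
    ∀ᵐ x ∂μ, extravagance (fun n => Real.log (1 / (gauss^[n] x : ℝ))) =
      processExtravagance (fun y => Real.log (partialQuotient y : ℝ)) gauss x := by
  filter_upwards [
    ae_all_iff.2 fun M : ℕ => ae_tendsto_div_of_mem_slowSet hμ measurable_log_partialQuotient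
      log_partialQuotient_nonneg M,
    ae_eq_zero_of_forall_mem_slowSet hμ measurable_log_partialQuotient
      log_partialQuotient_nonneg] with x hslow hzero
  have hsum : ∀ {M : ℝ}, x ∉ slowSet gauss (fun y => Real.log (partialQuotient y : ℝ)) M →
      ∀ᶠ n : ℕ in atTop, M * n ≤
        ∑ k ∈ Finset.range n, Real.log (partialQuotient (gauss^[k] x) : ℝ) := by
    intro M hM
    filter_upwards [not_frequently.1 (not_exists.1 hM 0)] with n hn
    rw [Nat.cast_zero, add_zero, not_lt] at hn
    exact hn
  rw [processExtravagance]
  -- Three cases: the averages of log a tend to infinity, are eventually bounded below by some 1/(m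
  -- + 1), or have lower limit 0; in the last two, some `slowSet` contains x.
  by_cases hfast : ∀ M : ℕ, x ∉ slowSet gauss (fun y => Real.log (partialQuotient y : ℝ)) M
  · exact (extravagance_eq_of_average_unbounded (fun n => log_partialQuotient_nonneg _)
      (fun n => log_partialQuotient_le _) (fun n => log_one_div_le _)
      fun M => hsum (hfast M)).symm
  · push Not at hfast
    obtain ⟨M, hM⟩ := hfast
    have hlim := hslow M hM
    have hlim' : Tendsto (fun n : ℕ => Real.log (1 / (gauss^[n] x : ℝ)) / n) atTop (nhds 0) := by
      have h := hlim.add (tendsto_const_div_atTop_nhds_zero_nat (Real.log 2))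
      rw [add_zero] at h
      refine squeeze_zero (fun n => div_nonneg (log_one_div_pos _).le (Nat.cast_nonneg n))
        (fun n => ?_) h
      rw [← add_div]
      exact div_le_div_of_nonneg_right (log_one_div_le _) (Nat.cast_nonneg n)
    rw [extravagance_eq_zero_of_tendsto (fun n => (log_one_div_pos _).le)
      (div_pos (Real.log_pos one_lt_two) three_pos) hlim' (eventually_le_sum_log_one_div x)]
    symm
    by_cases hall : ∀ m : ℕ,
        x ∈ slowSet gauss (fun y => Real.log (partialQuotient y : ℝ)) (1 / (m + 1))
    · rw [extravagance, if_neg]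
      rintro ⟨n, hn⟩
      exact hn.ne' (hzero hall n)
    · push Not at hall
      obtain ⟨m, hm⟩ := hall
      exact extravagance_eq_zero_of_tendsto (fun n => log_partialQuotient_nonneg _)
        (by positivity) hlim (hsum hm)

end PartialQuotients
end GaussCF

theorem lemma4p1 :
    (∀ x : GaussCF.UnitIrr,
      GaussCF.irrationalityExponent x =
        2 + GaussCF.extravagance (fun n => Real.log (1 / (GaussCF.gauss^[n] x : ℝ)))) ∧
    (∀ μ : Measure GaussCF.UnitIrr, IsProbabilityMeasure μ →
      MeasurePreserving GaussCF.gauss μ μ →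
      ∀ᵐ x ∂μ, GaussCF.irrationalityExponent x =
        2 + GaussCF.processExtravagance
          (fun y => Real.log (GaussCF.partialQuotient y : ℝ)) GaussCF.gauss x) := by
  refine ⟨GaussCF.irrationalityExponent_eq, fun μ _ hμ => ?_⟩
  filter_upwards [GaussCF.ae_extravagance_log_eq μ hμ] with x hx
  rw [GaussCF.irrationalityExponent_eq x, hx]
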